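/- Let $S$ be a ring (associative with $1$, not necessarily commutative), and consider right $S$-modules. Call a module *pure-projective* if it is isomorphic to a direct summand of a (possibly infinite) direct sum of finitely presented modules. For a module $X$, let $\mathrm{Add}(X)$ be the class of modules isomorphic to direct summands of arbitrary direct sums of copies of $X$; a module *has finite type* if it belongs to $\mathrm{Add}(X)$ for some module $X$ of finite length. A module $P$ is a *Prüfer module* if there is a surjective endomorphism $\phi$ of $P$ that is locally nilpotent (for every $x\in P$ there is $n\ge 0$ with $\phi^n(x)=0$) and whose kernel is nonzero and of finite length. Assume that all simple right $S$-modules are finitely presented, and let $P$ be a Prüfer right $S$-module. Then $P$ is pure-projective if and only if $P$ has finite type. -/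

import Mathlib

universe u v w

namespace PrueferModule

/-- `M` is isomorphic to a direct summand of `L`. -/
def IsSummandOf (R : Type u) [Ring R] (M : Type v) [AddCommGroup M] [Module R M]
    (L : Type w) [AddCommGroup L] [Module R L] : Prop :=
  ∃ A B : Submodule R L, IsCompl A B ∧ Nonempty (M ≃ₗ[R] A)

/-- `M` is pure-projective: it is isomorphic to a direct summand of a direct sum of finitely
presented modules. -/
def IsPureProjective (R : Type u) [Ring R] (M : Type v) [AddCommGroup M] [Module R M] : Prop :=
  ∃ (ι : Type (max u v)) (N : ι → Type (max u v)) (_ : ∀ i, AddCommGroup (N i))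
    (_ : ∀ i, Module R (N i)),
    (∀ i, Module.FinitePresentation R (N i)) ∧ IsSummandOf R M (DirectSum ι N)

/-- `M` belongs to `Add(X)`: it is isomorphic to a direct summand of a direct sum of
(arbitrarily many) copies of `X`. -/
def MemAdd (R : Type u) [Ring R] (M : Type v) [AddCommGroup M] [Module R M]
    (X : Type (max u v)) [AddCommGroup X] [Module R X] : Prop :=
  ∃ ι : Type (max u v), IsSummandOf R M (DirectSum ι (fun _ => X))

/-- `M` has finite type: it belongs to `Add(X)` for some module `X` of finite length. -/
def HasFiniteType (R : Type u) [Ring R] (M : Type v) [AddCommGroup M] [Module R M] : Prop :=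
  ∃ (X : Type (max u v)) (_ : AddCommGroup X) (_ : Module R X),
    IsFiniteLength R X ∧ MemAdd R M X

/-- `P` is a Prüfer module: it has a locally nilpotent surjective endomorphism whose kernel is
nonzero and of finite length. -/
def IsPruefer (R : Type u) [Ring R] (P : Type v) [AddCommGroup P] [Module R P] : Prop :=
  ∃ φ : Module.End R P,
    (∀ x : P, ∃ n : ℕ, (φ ^ n) x = 0) ∧
    Function.Surjective φ ∧
    LinearMap.ker φ ≠ ⊥ ∧
    IsFiniteLength R (LinearMap.ker φ)

end PrueferModule

namespace PrueferModule

section Summands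

variable {R : Type u} [Ring R] {M : Type v} [AddCommGroup M] [Module R M]
  {L : Type w} [AddCommGroup L] [Module R L]

/-! Finite length modules are finitely presented by dévissage, so finite type implies
pure-projective. Conversely, pure-projectivity yields an endomorphism `f` with range in a finitely
generated submodule and `f = 1` on `ker φ`. Then `1 - f = qφ`, and iterating gives `x = ∑ q^j f φ^j
x`, a finite sum by local nilpotence. This splits `P` off a countable direct sum of copies of `range
f`, which has finite length because it lies in some `ker φ^n`. -/

theorem isSummandOf_iff_exists_leftInverse :
    IsSummandOf R M L ↔ ∃ (i : M →ₗ[R] L) (r : L →ₗ[R] M), ∀ x, r (i x) = x := by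
  constructor
  · rintro ⟨A, B, hAB, ⟨e⟩⟩
    refine ⟨A.subtype ∘ₗ e.toLinearMap, e.symm.toLinearMap ∘ₗ A.projectionOnto B hAB, fun x => ?_⟩
    simp
  · rintro ⟨i, r, h⟩
    have hi : Function.Injective i := Function.LeftInverse.injective h
    refine ⟨LinearMap.range i, LinearMap.ker r, ?_, ⟨LinearEquiv.ofInjective i hi⟩⟩
    refine ⟨Submodule.disjoint_def.mpr ?_, codisjoint_iff.mpr (eq_top_iff.mpr fun y _ => ?_)⟩
    · rintro _ ⟨x, rfl⟩ hx
      rw [LinearMap.mem_ker, h] at hx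
      rw [hx, map_zero]
    · refine Submodule.mem_sup.mpr ⟨i (r y), ⟨r y, rfl⟩, y - i (r y), ?_, by abel⟩
      rw [LinearMap.mem_ker, map_sub, h, sub_self]

/-- A finitely supported family of linear maps `M → X`, as a map into the direct sum. -/
noncomputable def finsuppOfLocallyFinite {ι : Type*} {X : Type*} [AddCommGroup X] [Module R X]
    (g : ι → M →ₗ[R] X) (hg : ∀ x, (Function.support fun i => g i x).Finite) :
    M →ₗ[R] ι →₀ X where
  toFun x := Finsupp.ofSupportFinite (fun i => g i x) (hg x)
  map_add' x y := by ext i; exact map_add (g i) x y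
  map_smul' c x := by ext i; exact map_smul (g i) c x

end Summands

section FiniteLength

variable {R : Type u} [Ring R]

theorem _root_.IsFiniteLength.finitePresentation
    (hR : ∀ (T : Type u) [AddCommGroup T] [Module R T],
      IsSimpleModule R T → Module.FinitePresentation R T)
    {X : Type w} [AddCommGroup X] [Module R X] (hX : IsFiniteLength R X) :
    Module.FinitePresentation R X := by
  induction hX with
  | of_subsingleton => infer_instance
  | @of_simple_quotient M _ _ N hs _ ih =>
    -- Replacing the simple quotient by `R ⧸ I` brings it into universe `u`, where `hR` applies.
    obtain ⟨I, _, ⟨e⟩⟩ := isSimpleModule_iff_quot_maximal.mp hs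
    have : Module.FinitePresentation R (R ⧸ I) := hR _ ((LinearEquiv.isSimpleModule_iff e).mp hs)
    have : Module.FinitePresentation R (M ⧸ N) := .of_equiv e.symm
    have : Module.FinitePresentation R (LinearMap.ker N.mkQ) := by rwa [Submodule.ker_mkQ]
    exact Module.finitePresentation_of_ker N.mkQ N.mkQ_surjective

variable {P : Type v} [AddCommGroup P] [Module R P]

theorem isFiniteLength_of_le {A B : Submodule R P} (hAB : A ≤ B) (hB : IsFiniteLength R B) :
    IsFiniteLength R A := by
  rw [isFiniteLength_iff_isNoetherian_isArtinian] at hB ⊢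
  obtain ⟨_, _⟩ := hB
  exact ⟨isNoetherian_of_le hAB, isArtinian_of_le hAB⟩

/-- `φ` maps `ker φ^(n+1)` to `ker φ^n` with kernel `ker φ`, so finite length propagates by
induction. -/
theorem isFiniteLength_ker_pow {φ : Module.End R P} (hφ : IsFiniteLength R (LinearMap.ker φ))
    (n : ℕ) : IsFiniteLength R (LinearMap.ker (φ ^ n)) := by
  induction n with
  | zero =>
    rw [pow_zero, Module.End.one_eq_id, LinearMap.ker_id]
    exact .of_subsingleton
  | succ n ih =>
    rw [isFiniteLength_iff_isNoetherian_isArtinian] at hφ ih ⊢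
    obtain ⟨_, _⟩ := hφ
    obtain ⟨_, _⟩ := ih
    let g : LinearMap.ker (φ ^ (n + 1)) →ₗ[R] LinearMap.ker (φ ^ n) :=
      φ.restrict fun x hx => by
        rw [LinearMap.mem_ker] at hx ⊢
        rw [← hx, pow_succ, Module.End.mul_apply]
    have hle : LinearMap.ker φ ≤ LinearMap.ker (φ ^ (n + 1)) := fun x hx => by
      rw [LinearMap.mem_ker] at hx ⊢
      rw [pow_succ, Module.End.mul_apply, hx, map_zero]
    have hex : LinearMap.range (Submodule.inclusion hle) = LinearMap.ker g := by
      ext x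
      rw [Submodule.range_inclusion, Submodule.mem_comap, LinearMap.mem_ker, LinearMap.mem_ker,
        Subtype.ext_iff]
      rfl
    exact ⟨isNoetherian_of_range_eq_ker _ g hex, isArtinian_of_range_eq_ker _ g hex⟩

theorem exists_le_ker_pow_of_fg {φ : Module.End R P} (hφ : ∀ x, ∃ n : ℕ, (φ ^ n) x = 0)
    {A : Submodule R P} (hA : A.FG) : ∃ n : ℕ, A ≤ LinearMap.ker (φ ^ n) := by
  obtain ⟨t, rfl⟩ := hA
  choose n hn using hφ
  refine ⟨t.sup n, Submodule.span_le.mpr fun x hx => ?_⟩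
  exact Module.End.pow_map_zero_of_le (Finset.le_sup hx) (hn x)

end FiniteLength

section Telescope

variable {R : Type u} [Ring R] {P : Type v} [AddCommGroup P] [Module R P]

/-- A pure-projective module has, for every finitely generated submodule, an endomorphism with
range contained in a finitely generated submodule that is the identity on the given submodule. -/
theorem IsPureProjective.exists_end_range_le_fg (hP : IsPureProjective R P)
    {K : Submodule R P} (hK : K.FG) :
    ∃ (f : Module.End R P) (A : Submodule R P), A.FG ∧ LinearMap.range f ≤ A ∧ ∀ x ∈ K, f x = x := by
  classical
  obtain ⟨ι, N, _, _, hN, hsum⟩ := hP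
  obtain ⟨i, r, hir⟩ := isSummandOf_iff_exists_leftInverse.mp hsum
  obtain ⟨t, rfl⟩ := hK
  -- Only finitely many coordinates occur in the generators of `K`; truncating to them before
  -- applying `r` fixes `K`.
  let F : Finset ι := t.biUnion fun x => (i x).support
  let f : Module.End R P := ∑ j ∈ F, (r ∘ₗ DirectSum.lof R ι N j) ∘ₗ DirectSum.component R ι N j ∘ₗ i
  refine ⟨f, ⨆ j ∈ F, LinearMap.range (r ∘ₗ DirectSum.lof R ι N j), ?_, ?_, fun x hx => ?_⟩
  · refine Submodule.fg_biSup F _ fun j _ => ?_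
    have : Module.Finite R (N j) := inferInstance
    rw [LinearMap.range_eq_map]
    exact Module.Finite.fg_top.map _
  · rintro _ ⟨x, rfl⟩
    rw [LinearMap.sum_apply]
    refine Submodule.sum_mem _ fun j hj => ?_
    have hle : LinearMap.range (r ∘ₗ DirectSum.lof R ι N j) ≤
        ⨆ j ∈ F, LinearMap.range (r ∘ₗ DirectSum.lof R ι N j) :=
      le_biSup (fun j => LinearMap.range (r ∘ₗ DirectSum.lof R ι N j)) hj
    exact hle ⟨DirectSum.component R ι N j (i x), rfl⟩
  · have hx' : Set.EqOn f (LinearMap.id : P →ₗ[R] P) (Submodule.span R (t : Set P)) := by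
      refine LinearMap.eqOn_span fun y hy => ?_
      have hsub : (i y).support ⊆ F := Finset.subset_biUnion_of_mem (fun x => (i x).support) hy
      calc f y = ∑ j ∈ F, r (DirectSum.of N j (i y j)) := by
            simp only [f, LinearMap.sum_apply, LinearMap.comp_apply]; rfl
        _ = r (∑ j ∈ (i y).support, DirectSum.of N j (i y j)) := by
            rw [map_sum]
            refine (Finset.sum_subset hsub fun j _ hj => ?_).symm
            rw [DFinsupp.notMem_support_iff.mp hj, map_zero, map_zero]
        _ = y := by rw [DirectSum.sum_support_of, hir]
    exact hx' hx

/-- If `f` is the identity on the kernel of a surjective endomorphism `φ`, then `1 - f` factors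
through `φ`. -/
theorem exists_comp_eq_sub {φ f : Module.End R P} (hφ : Function.Surjective φ)
    (hf : ∀ x ∈ LinearMap.ker φ, f x = x) : ∃ q : Module.End R P, ∀ x, q (φ x) = x - f x := by
  have hker : LinearMap.ker φ ≤ LinearMap.ker (LinearMap.id - f) := fun x hx => by
    simp [hf x hx]
  refine ⟨(LinearMap.ker φ).liftQ _ hker ∘ₗ (φ.quotKerEquivOfSurjective hφ).symm.toLinearMap,
    fun x => ?_⟩
  have : (φ.quotKerEquivOfSurjective hφ).symm (φ x) = Submodule.Quotient.mk x := by
    rw [LinearEquiv.symm_apply_eq]; rfl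
  simp [this]

/-- Substituting `f = 1 - qφ` makes the sum telescope. -/
theorem sum_range_pow_apply {φ f q : Module.End R P} (hq : ∀ x, q (φ x) = x - f x) (x : P)
    (n : ℕ) : ∑ j ∈ Finset.range n, (q ^ j) (f ((φ ^ j) x)) = x - (q ^ n) ((φ ^ n) x) := by
  induction n with
  | zero => simp
  | succ n ih =>
    rw [Finset.sum_range_succ, ih, pow_succ q, pow_succ' φ, Module.End.mul_apply,
      Module.End.mul_apply, hq, map_sub]
    abel

/-- The embedding is `x ↦ (f φ^j x)_j`; the retraction applies `q^j` to coordinate `j` and adds up.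
-/
theorem isSummandOf_finsupp_range {φ f : Module.End R P}
    (hφ : Function.Surjective φ) (hnil : ∀ x, ∃ n : ℕ, (φ ^ n) x = 0)
    (hf : ∀ x ∈ LinearMap.ker φ, f x = x) : IsSummandOf R P (ℕ →₀ LinearMap.range f) := by
  obtain ⟨q, hq⟩ := exists_comp_eq_sub hφ hf
  have hvanish : ∀ x n, (φ ^ n) x = 0 → ∀ j, f.rangeRestrict ((φ ^ j) x) ≠ 0 → j < n := by
    intro x n hn j hj
    by_contra! hle
    exact hj (by rw [Module.End.pow_map_zero_of_le hle hn, map_zero])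
  let g : ℕ → P →ₗ[R] LinearMap.range f := fun j => f.rangeRestrict ∘ₗ (φ ^ j)
  have hg : ∀ x, (Function.support fun j => g j x).Finite := fun x => by
    obtain ⟨n, hn⟩ := hnil x
    exact (Set.finite_Iio n).subset fun j hj => hvanish x n hn j hj
  refine isSummandOf_iff_exists_leftInverse.mpr ⟨finsuppOfLocallyFinite g hg,
    Finsupp.lsum ℕ fun j => (q ^ j) ∘ₗ (LinearMap.range f).subtype, fun x => ?_⟩
  obtain ⟨n, hn⟩ := hnil x
  rw [Finsupp.lsum_apply, Finsupp.sum_of_support_subset _ (s := Finset.range n) _ _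
    (fun _ _ => map_zero _)]
  · have := sum_range_pow_apply hq x n
    rw [hn, map_zero, sub_zero] at this
    exact this
  · intro j hj
    exact Finset.mem_range.mpr (hvanish x n hn j (Finsupp.mem_support_iff.mp hj))

theorem IsPruefer.hasFiniteType_of_isPureProjective (hP : IsPruefer R P)
    (hpp : IsPureProjective R P) : HasFiniteType R P := by
  classical
  obtain ⟨φ, hnil, hsurj, -, hfl⟩ := hP
  obtain ⟨_, _⟩ := isFiniteLength_iff_isNoetherian_isArtinian.mp hfl
  obtain ⟨f, A, hfg, hfA, hf⟩ := hpp.exists_end_range_le_fg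
    (Module.Finite.iff_fg.mp (inferInstance : Module.Finite R (LinearMap.ker φ)))
  obtain ⟨n, hn⟩ := exists_le_ker_pow_of_fg hnil hfg
  have hA : IsFiniteLength R (LinearMap.range f) :=
    isFiniteLength_of_le (hfA.trans hn) (isFiniteLength_ker_pow hfl n)
  obtain ⟨i, r, hir⟩ := isSummandOf_iff_exists_leftInverse.mp
    (isSummandOf_finsupp_range hsurj hnil hf)
  -- The lifts only adjust universes to those in `HasFiniteType`.
  let e : (ℕ →₀ LinearMap.range f) ≃ₗ[R]
      DirectSum (ULift.{max u v} ℕ) fun _ => ULift.{max u v} (LinearMap.range f) :=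
    Finsupp.lcongr Equiv.ulift.symm ULift.moduleEquiv.symm ≪≫ₗ finsuppLEquivDirectSum R _ _
  refine ⟨ULift.{max u v} (LinearMap.range f), inferInstance, inferInstance,
    ULift.moduleEquiv.symm.isFiniteLength hA, ULift.{max u v} ℕ,
    isSummandOf_iff_exists_leftInverse.mpr
      ⟨e.toLinearMap ∘ₗ i, r ∘ₗ e.symm.toLinearMap, fun x => by simp [hir]⟩⟩

theorem HasFiniteType.isPureProjective
    (hR : ∀ (T : Type u) [AddCommGroup T] [Module R T],
      IsSimpleModule R T → Module.FinitePresentation R T)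
    (h : HasFiniteType R P) : IsPureProjective R P := by
  obtain ⟨X, _, _, hX, ι, hι⟩ := h
  exact ⟨ι, fun _ => X, inferInstance, inferInstance, fun _ => hX.finitePresentation hR, hι⟩

end Telescope

end PrueferModule

/-- Right `S`-modules are modules over the opposite ring `Sᵐᵒᵖ`. Every simple right `S`-module
is cyclic, hence isomorphic to one in the universe of `S`. -/
theorem mainTheorem8 (S : Type u) [Ring S]
    (hS : ∀ (T : Type u) [AddCommGroup T] [Module Sᵐᵒᵖ T],
      IsSimpleModule Sᵐᵒᵖ T → Module.FinitePresentation Sᵐᵒᵖ T)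
    (P : Type v) [AddCommGroup P] [Module Sᵐᵒᵖ P]
    (hP : PrueferModule.IsPruefer Sᵐᵒᵖ P) :
    PrueferModule.IsPureProjective Sᵐᵒᵖ P ↔ PrueferModule.HasFiniteType Sᵐᵒᵖ P :=
  ⟨hP.hasFiniteType_of_isPureProjective, fun h => h.isPureProjective hS⟩
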